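/- Let $(\Omega,\mathcal F,P)$ be a probability space with a filtration $(\mathcal F_t)_{t=0}^{N}$, let $\bar T\in\mathbb N$ and $\delta>0$ (the length of a day), and for $t=0,\dots,N$ let the forward curve $F_t=(F_t(s))_{s=0}^{\bar T}$ be an $\mathcal F_t$-measurable random vector in $\mathbb R^{\bar T+1}$. Suppose that, at each time $t$, the zero-coupon bonds with $T=1,\dots,\bar T+1$ days to maturity can be traded without frictions at the prices $$P_t(T)=e^{-\sum_{s=0}^{T-1}F_t(s)\delta},\qquad P_t(0)=1 .$$ A trading strategy is an adapted process $(\theta_t)_{t=0}^{N-1}$ in $\mathbb R^{\bar T+1}$, where $\theta_t^j$ is the number of units of the bond maturing at $t+1+j$, $j=0,\dots,\bar T$, held over $(t,t+1]$. Its wealth with zero initial capital is $W_0=0$, $W_{t+1}=\sum_{j=0}^{\bar T}\theta^j_tP_{t+1}(j)$, and it is self-financing if $\sum_{j=0}^{\bar T}\theta^j_tP_t(j+1)=W_t$ almost surely for all $t=0,\dots,N-1$. The market is arbitrage-free if every self-financing trading strategy with $W_0=0$ and $W_N\ge 0$ almost surely satisfies $W_N=0$ almost surely. For a random vector $X$ in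 $\mathbb R^d$, let $\operatorname{supp}_tX$ be its $\mathcal F_t$-conditional support, i.e. the smallest (up to null sets) closed-valued $\mathcal F_t$-measurable mapping $\Gamma:\Omega\rightrightarrows\mathbb R^d$ such that $X\in\Gamma$ almost surely, where measurability means $\{\omega:\Gamma(\omega)\cap U\neq\emptyset\}\in\mathcal F_t$ for every open $U\subseteq\mathbb R^d$. Let $\operatorname{co}$ and $\operatorname{ri}$ denote the convex hull and the relative interior. Then the market is arbitrage-free if and only if, almost surely, $$H\big((F_t(s))_{s=1}^{\bar T}\big)\in\operatorname{ri}\operatorname{co}H\big(\operatorname{supp}_t(F_{t+1}(s))_{s=0}^{\bar T-1}\big)\qquad\text{for all }t=0,\dots,N-1,$$ where $H:\mathbb R^{\bar T}\to\mathbb R^{\bar T}$ is $H=\exp\circ L$, with the exponential applied componentwise and $L$ equal to $-\delta$ times the lower-triangular all-ones matrix (ones on and below the diagonal). -/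

import Mathlib

open MeasureTheory ProbabilityTheory

/-- `Γ` is an `m`-measurable closed-valued mapping from `Ω` to the subsets of `E`: its values are
closed and `{ω | Γ ω ∩ U ≠ ∅}` belongs to `m` for every open `U`. -/
def IsMeasurableClosedValued {Ω E : Type*} (m : MeasurableSpace Ω) [TopologicalSpace E]
    (Γ : Ω → Set E) : Prop :=
  (∀ ω, IsClosed (Γ ω)) ∧ ∀ U : Set E, IsOpen U → MeasurableSet[m] {ω | (Γ ω ∩ U).Nonempty}

/-- `Γ` is (a version of) the `m`-conditional support of the random variable `X`: it is the smallest
`m`-measurable closed-valued mapping that contains `X` almost surely, inclusion being understood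
almost surely. -/
def IsCondSupport {Ω E : Type*} [TopologicalSpace E] (m : MeasurableSpace Ω)
    [_mΩ : MeasurableSpace Ω] (P : Measure Ω) (X : Ω → E) (Γ : Ω → Set E) : Prop :=
  IsMeasurableClosedValued m Γ ∧ (∀ᵐ ω ∂P, X ω ∈ Γ ω) ∧
    ∀ Γ' : Ω → Set E, IsMeasurableClosedValued m Γ' → (∀ᵐ ω ∂P, X ω ∈ Γ' ω) →
      ∀ᵐ ω ∂P, Γ ω ⊆ Γ' ω

/-- A regular conditional distribution of `X` given `Y`, as a family of measures. -/
theorem exists_condLaw {Ω Ω' E : Type*} [MeasurableSpace Ω] [MeasurableSpace Ω'] [MeasurableSpace E]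
    [StandardBorelSpace E] [Nonempty E] (P : Measure Ω) [IsFiniteMeasure P] {X : Ω → E}
    (hX : Measurable X) {Y : Ω → Ω'} (hY : Measurable Y) :
    ∃ κ : Ω' → Measure E, (∀ U, MeasurableSet U → Measurable fun y => κ y U) ∧
      ∀ (A : Set Ω') (U : Set E), MeasurableSet A → MeasurableSet U →
        ∫⁻ ω in Y ⁻¹' A, κ (Y ω) U ∂P = P (Y ⁻¹' A ∩ X ⁻¹' U) :=
  ⟨fun y => condDistrib X Y P y, fun _ hU => Kernel.measurable_coe _ hU, fun _ _ hA hU =>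
    setLIntegral_preimage_condDistrib hY hX.aemeasurable hU hA⟩

/-- Conditional supports exist: the support of a regular conditional distribution is one. -/
theorem exists_isCondSupport {Ω E : Type*} [TopologicalSpace E] [PolishSpace E]
    [MeasurableSpace E] [BorelSpace E] {m : MeasurableSpace Ω} [mΩ : MeasurableSpace Ω]
    (hm : m ≤ mΩ) (P : Measure Ω) [IsFiniteMeasure P] {X : Ω → E} (hX : Measurable X) :
    ∃ Γ : Ω → Set E, IsCondSupport m P X Γ := by
  rcases isEmpty_or_nonempty E with hE | hE
  · have hΩ : IsEmpty Ω := ⟨fun ω => hE.elim (X ω)⟩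
    refine ⟨fun _ => ∅, ⟨fun _ => isClosed_empty, fun U _ => ?_⟩, ?_, fun Γ' _ _ => ?_⟩
    · simp
    · exact Filter.Eventually.of_forall fun ω => hΩ.elim ω
    · exact Filter.Eventually.of_forall fun ω => hΩ.elim ω
  have hid : Measurable[mΩ, m] (id : Ω → Ω) := measurable_id.mono le_rfl hm
  obtain ⟨κ, hκm, key⟩ := @exists_condLaw Ω Ω E mΩ m _ _ _ P _ X hX id hid
  simp only [Set.preimage_id, id] at key
  obtain ⟨B, hBc, -, hB⟩ := TopologicalSpace.exists_countable_basis E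
  have hopen : ∀ (ω : Ω) (U : Set E), IsOpen U →
      (((κ ω).support ∩ U).Nonempty ↔ κ ω U ≠ 0) := by
    intro ω U hU
    constructor
    · rintro ⟨x, hx, hxU⟩
      exact ((Measure.mem_support_iff_forall x).1 hx U (hU.mem_nhds hxU)).ne'
    · intro h
      by_contra hne
      rw [Set.not_nonempty_iff_eq_empty] at hne
      apply h
      refine measure_mono_null (t := (κ ω).supportᶜ) ?_ Measure.measure_compl_support
      intro x hx hxs
      exact (Set.eq_empty_iff_forall_notMem.1 hne x) ⟨hxs, hx⟩
  refine ⟨fun ω => (κ ω).support, ⟨fun ω => Measure.isClosed_support, fun U hU => ?_⟩, ?_, ?_⟩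
  · simp only [hopen _ U hU]
    exact (hκm U hU.measurableSet) (measurableSet_singleton 0).compl
  · have h1 : ∀ U ∈ B, ∀ᵐ ω ∂P, κ ω U = 0 → X ω ∉ U := by
      intro U hU
      have hUo := (hB.isOpen hU).measurableSet
      have hA : MeasurableSet[m] {ω | κ ω U = 0} := (hκm U hUo) (measurableSet_singleton 0)
      have h2 := key _ U hA hUo
      rw [setLIntegral_congr_fun (g := fun _ => 0) (hm _ hA) (fun ω hω => hω)] at h2
      simp only [lintegral_zero] at h2
      rw [ae_iff]
      refine measure_mono_null ?_ h2.symm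
      intro ω hω
      simp only [Set.mem_ofPred_eq, Classical.not_imp, not_not] at hω
      exact hω
    filter_upwards [(ae_ball_iff hBc).2 h1] with ω hω
    rw [Measure.mem_support_iff_forall]
    intro U hU
    obtain ⟨V, hVB, hxV, hVU⟩ := hB.mem_nhds_iff.1 hU
    refine lt_of_lt_of_le (pos_iff_ne_zero.2 fun h0 => hω V hVB h0 hxV) (measure_mono hVU)
  · intro Γ' hΓ' hX'
    have h1 : ∀ U ∈ B, ∀ᵐ ω ∂P, ¬ (Γ' ω ∩ U).Nonempty → κ ω U = 0 := by
      intro U hU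
      have hUo := (hB.isOpen hU).measurableSet
      have hA : MeasurableSet[m] {ω | ¬ (Γ' ω ∩ U).Nonempty} := (hΓ'.2 U (hB.isOpen hU)).compl
      have h2 := key _ U hA hUo
      have h3 : P ({ω | ¬ (Γ' ω ∩ U).Nonempty} ∩ X ⁻¹' U) = 0 := by
        refine measure_mono_null ?_ (ae_iff.1 hX')
        rintro ω ⟨hω, hωU⟩ hmem
        exact hω ⟨X ω, hmem, hωU⟩
      rw [h3, setLIntegral_eq_zero_iff (hm _ hA) ((hκm U hUo).mono hm le_rfl)] at h2
      exact h2
    filter_upwards [(ae_ball_iff hBc).2 h1] with ω hω x hx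
    by_contra hxn
    obtain ⟨V, hVB, hxV, hVU⟩ := hB.mem_nhds_iff.1 ((hΓ'.1 ω).isOpen_compl.mem_nhds hxn)
    have h0 : κ ω V = 0 := hω V hVB fun ⟨y, hy, hyV⟩ => hVU hyV hy
    exact ((Measure.mem_support_iff_forall x).1 hx V ((hB.isOpen hVB).mem_nhds hxV)).ne' h0

open Classical in
/-- The `m`-conditional support of `X` (a version of it). -/
noncomputable def condSupport {Ω E : Type*} [TopologicalSpace E] (m : MeasurableSpace Ω)
    [_mΩ : MeasurableSpace Ω] (P : Measure Ω) (X : Ω → E) : Ω → Set E :=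
  if h : ∃ Γ : Ω → Set E, IsCondSupport m P X Γ then h.choose else fun _ => Set.univ

theorem isCondSupport_condSupport {Ω E : Type*} [TopologicalSpace E] [PolishSpace E]
    [MeasurableSpace E] [BorelSpace E] {m : MeasurableSpace Ω} [mΩ : MeasurableSpace Ω]
    (hm : m ≤ mΩ) (P : Measure Ω) [IsFiniteMeasure P] {X : Ω → E} (hX : Measurable X) :
    IsCondSupport m P X (condSupport m P X) := by
  have h := exists_isCondSupport hm P hX
  rw [condSupport, dif_pos h]
  exact h.choose_spec

/-- Price `e ^ (-∑_{s < T} f(s) δ)` of the zero-coupon bond that pays one unit of cash in `T` days,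
when the overnight forward curve is `f = (f(0), …, f(n))`; meaningful for `T ≤ n + 1`. -/
noncomputable def zcbPrice {n : ℕ} (δ : ℝ) (f : Fin (n + 1) → ℝ) (T : ℕ) : ℝ :=
  Real.exp (-∑ s : Fin (n + 1) with s.val < T, f s * δ)

/-- A trading strategy `θ` holds, over the period `(t, t + 1]`, `θ t ω j` units of the bond that
matures at time `t + 1 + j`, for `j = 0, …, n`. This is the cost of that portfolio at time `t`. -/
noncomputable def bondPortfolioCost {Ω : Type*} {n : ℕ} (δ : ℝ) (F : ℕ → Ω → Fin (n + 1) → ℝ)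
    (θ : ℕ → Ω → Fin (n + 1) → ℝ) (t : ℕ) (ω : Ω) : ℝ :=
  ∑ j : Fin (n + 1), θ t ω j * zcbPrice δ (F t ω) (j.val + 1)

/-- Wealth at time `t`, before rebalancing, of a trader with zero initial wealth who follows the
strategy `θ`: at time `t + 1`, the bond that matures at `t + 1 + j` has `j` days left and is worth
`P_{t+1}(j)` (with `P_{t+1}(0) = 1`, the payment of the bond maturing at `t + 1`). -/
noncomputable def bondWealth {Ω : Type*} {n : ℕ} (δ : ℝ) (F : ℕ → Ω → Fin (n + 1) → ℝ)
    (θ : ℕ → Ω → Fin (n + 1) → ℝ) : ℕ → Ω → ℝ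
  | 0, _ => 0
  | t + 1, ω => ∑ j : Fin (n + 1), θ t ω j * zcbPrice δ (F (t + 1) ω) j.val

/-- The frictionless bond market over the trading dates `0, …, N` is arbitrage-free: every adapted
self-financing strategy with zero initial wealth and almost surely nonnegative terminal wealth has
almost surely zero terminal wealth. -/
def BondMarketArbitrageFree {Ω : Type*} {mΩ : MeasurableSpace Ω} (P : Measure Ω)
    (ℱ : Filtration ℕ mΩ) {n : ℕ} (δ : ℝ) (F : ℕ → Ω → Fin (n + 1) → ℝ) (N : ℕ) : Prop :=
  ∀ θ : ℕ → Ω → Fin (n + 1) → ℝ,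
    (∀ t < N, Measurable[ℱ t] (θ t)) →
    (∀ t < N, ∀ᵐ ω ∂P, bondPortfolioCost δ F θ t ω = bondWealth δ F θ t ω) →
    (∀ᵐ ω ∂P, 0 ≤ bondWealth δ F θ N ω) →
    ∀ᵐ ω ∂P, bondWealth δ F θ N ω = 0

/-- The matrix `L`: `-δ` times the lower-triangular all-ones matrix. -/
def forwardMatrix (n : ℕ) (δ : ℝ) : Matrix (Fin n) (Fin n) ℝ :=
  (-δ) • Matrix.of fun i j => if j ≤ i then (1 : ℝ) else 0

/-- The function `H = exp ∘ L`, with the exponential applied componentwise. -/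
noncomputable def forwardToPrice (n : ℕ) (δ : ℝ) (z : Fin n → ℝ) : Fin n → ℝ :=
  fun i => Real.exp ((forwardMatrix n δ).mulVec z i)

/-!
Measured in units of the bond that matures at `t + 1`, the cost of a portfolio held over `(t, t + 1]`
is `θ⁰ + ⟪η, y⟫`, and its value in cash at `t + 1` is `θ⁰ + ⟪η, Y⟫`, where `y = H (F_t(1), …)`,
`Y = H (F_{t+1}(0), …)` and `η` collects the positions in the longer bonds. Hence the wealth at
`t + 1` is the wealth at `t`, compounded over one day, plus the gain `⟪η, Y - y⟫`
(`bondWealth_succ_eq_cost_add_gain`), and the market is arbitrage-free exactly when no single period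
admits an `ℱ t`-measurable `η` with nonnegative, not almost surely zero, gain
(`bondMarketArbitrageFree_iff_forall_bondGain`).

For one period (`forall_gain_eq_zero_iff_mem_intrinsicInterior`), the minimality of the conditional
support upgrades an almost sure inequality for `Z` to an inequality on the whole support
(`IsCondSupport.ae_forall_le`). If `y` is in the relative interior of the convex hull of the image
of the support, a nonnegative gain is thus zero
(`inner_sub_eq_zero_of_mem_intrinsicInterior`). Conversely, the random closed convex cone of all
portfolios with nonnegative gain on the support is measurable, and projecting a dense sequence onto
it gives a dense sequence of measurable selections
(`IsMeasurableClosedValued.exists_dense_selections`). Absence of arbitrage makes the gain of each of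
these countably many selections vanish on the support, almost surely, and by density that of every
element of the cone. A point that no functional separates properly from a convex set belongs to its
relative interior (`mem_intrinsicInterior_of_forall_inner`).
-/

/-! ### The relative interior of a convex set and linear functionals -/

section RelativeInterior

variable {V : Type*} [NormedAddCommGroup V] [InnerProductSpace ℝ V]

/-- A functional that attains its minimum over `C` at a point of the relative interior is constant
on `C`: the segment from `x` to `y` can be prolonged a little beyond `y` within `C`. -/
theorem inner_sub_eq_zero_of_mem_intrinsicInterior {C : Set V} {y η : V}
    (hy : y ∈ intrinsicInterior ℝ C) (hη : ∀ x ∈ C, 0 ≤ inner ℝ η (x - y)) {x : V} (hx : x ∈ C) :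
    inner ℝ η (x - y) = 0 := by
  obtain ⟨y', hy', rfl⟩ := mem_intrinsicInterior.1 hy
  have : Nonempty (affineSpan ℝ C) := ⟨y'⟩
  let g : ℝ → affineSpan ℝ C := fun t => AffineMap.lineMap y' ⟨x, subset_affineSpan ℝ C hx⟩ t
  have hg : Continuous g := AffineMap.lineMap_continuous
  have hval : ∀ t, (g t : V) = t • (x - y') + y' := fun t => by
    have : (g t : V) = AffineMap.lineMap (y' : V) x t :=
      (affineSpan ℝ C).subtype.apply_lineMap y' ⟨x, subset_affineSpan ℝ C hx⟩ t
    rw [this, AffineMap.lineMap_apply]; rfl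
  have hev : ∀ᶠ t in nhds (0 : ℝ), (g t : V) ∈ C := by
    have h0 : g 0 = y' := AffineMap.lineMap_apply_zero _ _
    have : interior ((↑) ⁻¹' C : Set (affineSpan ℝ C)) ∈ nhds (g 0) := by
      rw [h0]; exact isOpen_interior.mem_nhds hy'
    filter_upwards [hg.continuousAt this] with t ht
    have : g t ∈ ((↑) ⁻¹' C : Set (affineSpan ℝ C)) := interior_subset ht
    exact this
  obtain ⟨ε, hε, hball⟩ := Metric.eventually_nhds_iff.1 hev
  have h1 := hη _ (hball (y := -(ε / 2)) (by
    rw [Real.dist_eq, sub_zero, abs_neg, abs_of_pos (by linarith)]; linarith))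
  rw [hval, add_sub_cancel_right, inner_smul_right] at h1
  nlinarith [hη x hx]

/-- If `y` is not in the relative interior of `C`, some functional that is nowhere on `C`
smaller than at `y` is somewhere on `C` larger. The proof reduces to the direction space of `C`,
in which `C` has nonempty interior and the Hahn-Banach theorem applies. -/
theorem mem_intrinsicInterior_of_forall_inner [FiniteDimensional ℝ V] {C : Set V}
    (hC : Convex ℝ C) (hne : C.Nonempty) {y : V}
    (h : ∀ η : V, (∀ x ∈ C, 0 ≤ inner ℝ η (x - y)) → ∀ x ∈ C, inner ℝ η (x - y) = 0) :
    y ∈ intrinsicInterior ℝ C := by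
  obtain ⟨x₀, hx₀⟩ := hne
  let W : Submodule ℝ V := vectorSpan ℝ C
  have hsub : ∀ x ∈ C, x - x₀ ∈ W := fun x hx => vsub_mem_vectorSpan ℝ hx hx₀
  -- The component of `x₀ - y` orthogonal to `W` is constant on `C`, hence vanishes by `h`.
  have hy : x₀ - y ∈ W := by
    set r : V := (x₀ - y) - W.starProjection (x₀ - y) with hr
    have hrW : ∀ w ∈ W, inner ℝ r w = 0 := fun w hw =>
      W.starProjection_inner_eq_zero (x₀ - y) w hw
    have hval : ∀ x ∈ C, inner ℝ r (x - y) = inner ℝ r r := by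
      intro x hx
      have e : x - y = r + (W.starProjection (x₀ - y) + (x - x₀)) := by rw [hr]; abel
      rw [e, inner_add_right, hrW _ (W.add_mem (W.starProjection_apply_mem _) (hsub x hx)),
        add_zero]
    have h0 := h r (fun x hx => by rw [hval x hx]; exact real_inner_self_nonneg) x₀ hx₀
    rw [hval x₀ hx₀, inner_self_eq_zero, hr, sub_eq_zero] at h0
    rw [h0]; exact W.starProjection_apply_mem _
  have hsuby : ∀ x ∈ C, x - y ∈ W := fun x hx => by
    have : x - y = (x - x₀) + (x₀ - y) := by abel
    rw [this]; exact W.add_mem (hsub x hx) hy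
  let φ : W →ᵃⁱ[ℝ] V :=
    (AffineIsometryEquiv.vaddConst ℝ y).toAffineIsometry.comp W.subtypeₗᵢ.toAffineIsometry
  have hφ : ∀ w : W, φ w = (w : V) + y := fun w => rfl
  let C' : Set W := φ ⁻¹' C
  have himg : φ '' C' = C := by
    refine Set.image_preimage_eq_of_subset fun x hx => ⟨⟨x - y, hsuby x hx⟩, ?_⟩
    rw [hφ]; exact sub_add_cancel x y
  have hconv : Convex ℝ C' := hC.affine_preimage φ.toAffineMap
  have hspan : affineSpan ℝ C' = ⊤ := by
    have hmap : (affineSpan ℝ C').map φ.toAffineMap = affineSpan ℝ C := by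
      rw [AffineSubspace.map_span]
      exact congrArg _ himg
    rw [eq_top_iff]
    intro w _
    have hw : (w : V) + y ∈ affineSpan ℝ C := by
      have e : (w : V) + y = ((w : V) + (y - x₀)) +ᵥ x₀ := by
        simp only [vadd_eq_add]; abel
      rw [e]
      refine AffineSubspace.vadd_mem_of_mem_direction ?_ (subset_affineSpan ℝ C hx₀)
      rw [direction_affineSpan]
      refine W.add_mem w.2 ?_
      rw [← neg_sub]; exact W.neg_mem hy
    rw [← hmap] at hw
    obtain ⟨w', hw', e⟩ := hw
    have : w' = w := φ.injective (by rw [hφ w]; exact e)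
    rwa [← this]
  have hint : (interior C').Nonempty := hconv.interior_nonempty_iff_affineSpan_eq_top.2 hspan
  suffices h0 : (0 : W) ∈ interior C' by
    rw [← himg, φ.intrinsicInterior_image]
    refine ⟨0, interior_subset_intrinsicInterior h0, ?_⟩
    rw [hφ]; simp
  by_contra h0
  obtain ⟨f, hf⟩ := geometric_hahn_banach_open_point hconv.interior isOpen_interior h0
  rw [map_zero] at hf
  let ζ : W := (InnerProductSpace.toDual ℝ W).symm f
  have hζ : ∀ w : W, inner ℝ (ζ : V) (w : V) = f w := fun w => by
    rw [← Submodule.coe_inner]; exact InnerProductSpace.toDual_symm_apply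
  have hle : ∀ w ∈ C', f w ≤ 0 := by
    have hcl : C' ⊆ closure (interior C') := by
      rw [hconv.closure_interior_eq_closure_of_nonempty_interior hint]; exact subset_closure
    intro w hw
    exact closure_minimal (t := {w | f w ≤ 0}) (fun w hw => (hf w hw).le)
      (isClosed_le f.continuous continuous_const) (hcl hw)
  have hkey : ∀ x ∈ C, ∃ w ∈ C', inner ℝ (-(ζ : V)) (x - y) = - f w ∧ (w : V) = x - y := by
    intro x hx
    refine ⟨⟨x - y, hsuby x hx⟩, ?_, ?_, rfl⟩
    · change φ _ ∈ C
      rw [hφ]; simpa using hx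
    · rw [inner_neg_left]; exact congrArg _ (hζ ⟨x - y, hsuby x hx⟩)
  have hzero := h (-(ζ : V)) (fun x hx => by
    obtain ⟨w, hw, e, -⟩ := hkey x hx
    rw [e]; linarith [hle w hw])
  obtain ⟨w, hw⟩ := hint
  have hwC' : w ∈ C' := interior_subset hw
  have hwC : (w : V) + y ∈ C := hwC'
  have h2 := hzero _ hwC
  rw [add_sub_cancel_right, inner_neg_left, hζ] at h2
  linarith [hf w hw]

end RelativeInterior

/-! ### Measurable closed-valued mappings -/

section MeasurableMappings

variable {Ω : Type*} {m : MeasurableSpace Ω}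

theorem IsMeasurableClosedValued.measurableSet_exists_pos {E : Type*} [TopologicalSpace E]
    [SecondCountableTopology E] {Γ : Ω → Set E} (hΓ : IsMeasurableClosedValued m Γ)
    {f : Ω → E → ℝ} (hm : ∀ z, Measurable fun ω => f ω z) (hc : ∀ ω, Continuous (f ω)) :
    MeasurableSet {ω | ∃ z ∈ Γ ω, 0 < f ω z} := by
  obtain ⟨B, hBc, -, hB⟩ := TopologicalSpace.exists_countable_basis E
  obtain ⟨D, hDc, hD⟩ := TopologicalSpace.exists_countable_dense E
  have heq : {ω | ∃ z ∈ Γ ω, 0 < f ω z} = ⋃ U ∈ B, ⋃ n : ℕ, ({ω | (Γ ω ∩ U).Nonempty} ∩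
      ⋂ z ∈ U ∩ D, {ω | 1 / ((n : ℝ) + 1) ≤ f ω z}) := by
    ext ω
    simp only [Set.mem_ofPred_eq, Set.mem_iUnion, Set.mem_inter_iff, Set.mem_iInter, exists_prop]
    constructor
    · rintro ⟨z, hz, hpos⟩
      obtain ⟨n, hn⟩ := exists_nat_one_div_lt hpos
      obtain ⟨U, hUB, hzU, hU⟩ := hB.mem_nhds_iff.1
        ((isOpen_lt continuous_const (hc ω)).mem_nhds (show z ∈ {z | 1 / ((n : ℝ) + 1) < f ω z}
          from hn))
      exact ⟨U, hUB, n, ⟨z, hz, hzU⟩, fun z' hz' => (hU hz'.1).le⟩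
    · rintro ⟨U, hUB, n, ⟨z, hz, hzU⟩, h⟩
      refine ⟨z, hz, lt_of_lt_of_le (Nat.one_div_pos_of_nat (n := n)) ?_⟩
      exact closure_minimal (t := {z | 1 / ((n : ℝ) + 1) ≤ f ω z}) (fun z' hz' => h z' hz')
        (isClosed_le continuous_const (hc ω)) (hD.open_subset_closure_inter (hB.isOpen hUB) hzU)
  rw [heq]
  refine .biUnion hBc fun U hU => .iUnion fun n => (hΓ.2 U (hB.isOpen hU)).inter ?_
  exact .biInter (hDc.mono Set.inter_subset_right) fun z _ =>
    measurableSet_le measurable_const (hm z)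

/-- The set of parameters `x` at which a system of inequalities, indexed by a measurable closed
random set, is satisfied is again a measurable closed random set. Equicontinuity in `x` allows
feasibility over a compact set to be tested on a countable dense subset with vanishing tolerance. -/
theorem IsMeasurableClosedValued.setOf_forall_le {E X : Type*} [TopologicalSpace E]
    [SecondCountableTopology E] [MetricSpace X] [ProperSpace X] {Γ : Ω → Set E}
    (hΓ : IsMeasurableClosedValued m Γ) {f : Ω → X → E → ℝ}
    (hm : ∀ x z, Measurable fun ω => f ω x z) (hc : ∀ ω x, Continuous (f ω x))
    (he : ∀ ω, Equicontinuous fun z x => f ω x z) :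
    IsMeasurableClosedValued m fun ω => {x | ∀ z ∈ Γ ω, f ω x z ≤ 0} := by
  have hcx : ∀ ω z, Continuous fun x => f ω x z := fun ω z => (he ω).continuous z
  constructor
  · intro ω
    simp only [Set.ofPred_forall]
    exact isClosed_biInter fun z _ => isClosed_le (hcx ω z) continuous_const
  intro U hU
  have : LocallyCompactSpace U := hU.locallyCompactSpace
  obtain ⟨K, hK, hKU⟩ : IsSigmaCompact U := isSigmaCompact_iff_sigmaCompactSpace.2 inferInstance
  choose D hDK hDc hD using fun n =>
    (TopologicalSpace.IsSeparable.of_separableSpace (K n)).exists_countable_dense_subset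
  have heq : {ω | ({x | ∀ z ∈ Γ ω, f ω x z ≤ 0} ∩ U).Nonempty} = ⋃ n, ⋂ k : ℕ, ⋃ x ∈ D n,
      {ω | ∃ z ∈ Γ ω, 0 < f ω x z - 1 / ((k : ℝ) + 1)}ᶜ := by
    ext ω
    simp only [Set.mem_ofPred_eq, Set.mem_iUnion, Set.mem_iInter, exists_prop, Set.mem_compl_iff,
      not_exists, not_and, not_lt, sub_nonpos]
    constructor
    · rintro ⟨x, hx, hxU⟩
      rw [← hKU] at hxU
      obtain ⟨n, hxn⟩ := Set.mem_iUnion.1 hxU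
      refine ⟨n, fun k => ?_⟩
      obtain ⟨ε, hε, hball⟩ := Metric.equicontinuousAt_iff.1 (he ω x) _
        (Nat.one_div_pos_of_nat (α := ℝ) (n := k))
      obtain ⟨x', hx', hdist⟩ := Metric.mem_closure_iff.1 (hD n hxn) ε hε
      refine ⟨x', hx', fun z hz => ?_⟩
      have h1 := hball x' (by rwa [dist_comm]) z
      rw [Real.dist_eq] at h1
      linarith [(abs_lt.1 h1).1, hx z hz]
    · rintro ⟨n, h⟩
      choose x hxD hx using h
      obtain ⟨a, haK, s, hs, hlim⟩ := (hK n).tendsto_subseq fun k => hDK n (hxD k)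
      refine ⟨a, fun z hz => ?_, ?_⟩
      · exact le_of_tendsto_of_tendsto' (((hcx ω z).tendsto a).comp hlim)
          (tendsto_one_div_add_atTop_nhds_zero_nat.comp hs.tendsto_atTop)
          fun k => hx (s k) z hz
      · rw [← hKU]; exact Set.mem_iUnion.2 ⟨n, haK⟩
  rw [heq]
  refine .iUnion fun n => .iInter fun k => .biUnion (hDc n) fun x _ => ?_
  exact (hΓ.measurableSet_exists_pos (fun z => (hm x z).sub_const _)
    fun ω => (hc ω x).sub continuous_const).compl

theorem isMeasurableClosedValued_setOf_le {X : Type*} [MetricSpace X] [ProperSpace X]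
    {f : Ω → X → ℝ} (hm : ∀ x, Measurable fun ω => f ω x) (hc : ∀ ω, Continuous (f ω)) :
    IsMeasurableClosedValued m fun ω => {x | f ω x ≤ 0} := by
  have hΓ : IsMeasurableClosedValued m fun _ : Ω => (Set.univ : Set Unit) :=
    ⟨fun _ => isClosed_univ, fun U _ => MeasurableSet.const _⟩
  have := hΓ.setOf_forall_le (X := X) (f := fun ω x _ => f ω x) (fun x _ => hm x)
    (fun _ _ => continuous_const)
    fun ω x => Metric.equicontinuousAt_iff.2 fun ε hε =>
      (Metric.continuousAt_iff.1 (hc ω).continuousAt ε hε).imp fun d hd =>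
        ⟨hd.1, fun x' hx' _ => by rw [dist_comm]; exact hd.2 hx'⟩
  simpa using this

theorem IsMeasurableClosedValued.measurableSet_inter_isCompact {X : Type*} [MetricSpace X]
    {Γ : Ω → Set X} (hΓ : IsMeasurableClosedValued m Γ) {L : Set X} (hL : IsCompact L) :
    MeasurableSet {ω | (Γ ω ∩ L).Nonempty} := by
  have heq : {ω | (Γ ω ∩ L).Nonempty} =
      ⋂ n : ℕ, {ω | (Γ ω ∩ Metric.thickening (1 / ((n : ℝ) + 1)) L).Nonempty} := by
    ext ω
    simp only [Set.mem_ofPred_eq, Set.mem_iInter]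
    constructor
    · intro h n
      exact h.mono (Set.inter_subset_inter_right _
        (Metric.self_subset_thickening Nat.one_div_pos_of_nat L))
    · intro h
      by_contra hne
      rw [← Set.not_disjoint_iff_nonempty_inter, not_not] at hne
      obtain ⟨ε, hε, hd⟩ := hne.symm.exists_thickenings hL (hΓ.1 ω)
      obtain ⟨n, hn⟩ := exists_nat_one_div_lt hε
      obtain ⟨x, hx, hxL⟩ := h n
      exact Set.disjoint_left.1 hd (Metric.thickening_mono hn.le L hxL)
        (Metric.self_subset_thickening hε _ hx)
  rw [heq]
  exact .iInter fun n => hΓ.2 _ Metric.isOpen_thickening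

/-- The metric projection of a fixed point onto a measurable closed convex random set is a
measurable selection. Since the projection is the only nearest point, it lies in a closed set `C`
exactly when every ball around `q` that meets the random set meets it within `C`. -/
theorem IsMeasurableClosedValued.exists_measurable_projection {V : Type*} [NormedAddCommGroup V]
    [InnerProductSpace ℝ V] [FiniteDimensional ℝ V] [MeasurableSpace V] [BorelSpace V]
    {K : Ω → Set V} (hK : IsMeasurableClosedValued m K) (hconv : ∀ ω, Convex ℝ (K ω))
    (hne : ∀ ω, (K ω).Nonempty) (q : V) :
    ∃ p : Ω → V, Measurable p ∧ ∀ ω, p ω ∈ K ω ∧ ∀ x ∈ K ω, ‖q - p ω‖ ≤ ‖q - x‖ := by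
  have : ProperSpace V := FiniteDimensional.proper ℝ V
  choose p hp hmin using fun ω =>
    exists_norm_eq_iInf_of_complete_convex (hne ω) (hK.1 ω).isComplete (hconv ω) q
  have hle : ∀ ω, ∀ x ∈ K ω, ‖q - p ω‖ ≤ ‖q - x‖ := fun ω x hx => by
    rw [hmin ω]
    exact ciInf_le ⟨0, by rintro _ ⟨w, rfl⟩; exact norm_nonneg _⟩ (⟨x, hx⟩ : K ω)
  have huniq : ∀ ω, ∀ x ∈ K ω, ‖q - x‖ ≤ ‖q - p ω‖ → x = p ω := by
    intro ω x hx hxle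
    have h1 := (norm_eq_iInf_iff_real_inner_le_zero (hconv ω) (hp ω)).1 (hmin ω) x hx
    have h2 : ‖q - x‖ ^ 2 = ‖q - p ω‖ ^ 2 - 2 * inner ℝ (q - p ω) (x - p ω) + ‖x - p ω‖ ^ 2 := by
      rw [← norm_sub_sq_real]; congr 2; abel
    have h3 : ‖q - x‖ ^ 2 ≤ ‖q - p ω‖ ^ 2 := pow_le_pow_left₀ (norm_nonneg _) hxle 2
    have h4 : ‖x - p ω‖ ^ 2 = 0 := le_antisymm (by linarith) (sq_nonneg _)
    exact sub_eq_zero.1 (norm_eq_zero.1 (pow_eq_zero_iff two_ne_zero |>.1 h4))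
  refine ⟨p, measurable_of_isClosed fun C hC => ?_, fun ω => ⟨hp ω, hle ω⟩⟩
  have heq : p ⁻¹' C = ⋂ r : ℚ, ({ω | (K ω ∩ Metric.ball q r).Nonempty}ᶜ ∪
      {ω | (K ω ∩ (Metric.closedBall q r ∩ C)).Nonempty}) := by
    ext ω
    simp only [Set.mem_preimage, Set.mem_iInter, Set.mem_union, Set.mem_compl_iff,
      Set.mem_ofPred_eq, ← imp_iff_not_or]
    constructor
    · rintro hpC r ⟨x, hx, hxr⟩
      refine ⟨p ω, hp ω, ?_, hpC⟩
      rw [mem_ball_iff_norm'] at hxr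
      rw [mem_closedBall_iff_norm']
      exact (hle ω x hx).trans hxr.le
    · intro h
      -- A point of `K ω ∩ C` nearest to `q` is no farther from `q` than the projection.
      have hcompact : IsCompact (K ω ∩ C ∩ Metric.closedBall q (‖q - p ω‖ + 1)) :=
        (isCompact_closedBall q _).inter_left ((hK.1 ω).inter hC)
      have hex : ∀ r : ℚ, ‖q - p ω‖ < r → ∃ x ∈ K ω ∩ C, ‖q - x‖ ≤ r := fun r hr => by
        obtain ⟨x, hx, hxr, hxC⟩ := h r ⟨p ω, hp ω, mem_ball_iff_norm'.2 hr⟩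
        exact ⟨x, ⟨hx, hxC⟩, mem_closedBall_iff_norm'.1 hxr⟩
      have hnonempty : (K ω ∩ C ∩ Metric.closedBall q (‖q - p ω‖ + 1)).Nonempty := by
        obtain ⟨r, hr1, hr2⟩ := exists_rat_btwn (lt_add_one ‖q - p ω‖)
        obtain ⟨x, hx, hxr⟩ := hex r hr1
        exact ⟨x, hx, mem_closedBall_iff_norm'.2 (hxr.trans hr2.le)⟩
      obtain ⟨a, ⟨⟨haK, haC⟩, haB⟩, hamin⟩ := hcompact.exists_isMinOn hnonempty
        (f := fun x => ‖q - x‖) (by fun_prop)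
      have hale : ‖q - a‖ ≤ ‖q - p ω‖ := by
        by_contra! hlt
        obtain ⟨r, hr1, hr2⟩ := exists_rat_btwn hlt
        obtain ⟨x, hx, hxr⟩ := hex r hr1
        have hxB : x ∈ Metric.closedBall q (‖q - p ω‖ + 1) := mem_closedBall_iff_norm'.2
          ((hxr.trans hr2.le).trans (mem_closedBall_iff_norm'.1 haB))
        have : ‖q - a‖ ≤ ‖q - x‖ := hamin ⟨hx, hxB⟩
        linarith
      rw [← huniq ω a haK hale]; exact haC
  rw [heq]
  refine .iInter fun r => (hK.2 _ Metric.isOpen_ball).compl.union ?_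
  exact hK.measurableSet_inter_isCompact ((isCompact_closedBall q _).inter_right hC)

/-- A Castaing representation for convex values, obtained by projecting a dense sequence. -/
theorem IsMeasurableClosedValued.exists_dense_selections {V : Type*} [NormedAddCommGroup V]
    [InnerProductSpace ℝ V] [FiniteDimensional ℝ V] [MeasurableSpace V] [BorelSpace V]
    {K : Ω → Set V} (hK : IsMeasurableClosedValued m K) (hconv : ∀ ω, Convex ℝ (K ω))
    (hne : ∀ ω, (K ω).Nonempty) :
    ∃ p : ℕ → Ω → V, (∀ n, Measurable (p n)) ∧ (∀ n ω, p n ω ∈ K ω) ∧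
      ∀ ω, K ω ⊆ closure (Set.range fun n => p n ω) := by
  choose p hpm hp using fun n =>
    hK.exists_measurable_projection hconv hne (TopologicalSpace.denseSeq V n)
  refine ⟨p, hpm, fun n ω => (hp n ω).1, fun ω x hx => Metric.mem_closure_range_iff.2 ?_⟩
  intro ε hε
  obtain ⟨n, hn⟩ := (TopologicalSpace.denseRange_denseSeq V).exists_dist_lt x (half_pos hε)
  refine ⟨n, ?_⟩
  have h1 := (hp n ω).2 x hx
  rw [← dist_eq_norm, ← dist_eq_norm] at h1
  rw [dist_comm] at hn
  have h2 := dist_triangle_left x (p n ω) (TopologicalSpace.denseSeq V n)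
  linarith

end MeasurableMappings

/-! ### Absence of arbitrage over one period -/

/-- The random cone of portfolios whose gain is nonnegative on the random set `Γ` is measurable.
Dividing the gain by `1 + ‖H z - y ω‖` leaves its sign unchanged and makes it Lipschitz in the
portfolio, uniformly in the scenario. -/
theorem IsMeasurableClosedValued.setOf_forall_inner_nonneg {Ω E V : Type*} {m : MeasurableSpace Ω}
    [TopologicalSpace E] [SecondCountableTopology E] [NormedAddCommGroup V]
    [InnerProductSpace ℝ V] [FiniteDimensional ℝ V] [MeasurableSpace V] [BorelSpace V]
    {Γ : Ω → Set E} (hΓ : IsMeasurableClosedValued m Γ) {H : E → V} (hH : Continuous H)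
    {y : Ω → V} (hy : Measurable y) :
    IsMeasurableClosedValued m fun ω => {η : V | ∀ z ∈ Γ ω, 0 ≤ inner ℝ η (H z - y ω)} := by
  have : ProperSpace V := FiniteDimensional.proper ℝ V
  have hpos : ∀ v : V, 0 < 1 + ‖v‖ := fun v => by positivity
  have h := hΓ.setOf_forall_le (X := V)
    (f := fun ω η z => inner ℝ η (y ω - H z) / (1 + ‖y ω - H z‖)) ?_ ?_ ?_
  · convert h using 3 with ω
    refine Set.ext fun η => forall₂_congr fun z _ => ?_
    rw [div_le_iff₀ (hpos _), zero_mul, ← neg_sub (y ω), inner_neg_right]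
    simp
  · intro η z
    have h1 : Measurable fun ω => y ω - H z := hy.sub_const _
    exact (h1.const_inner (𝕜 := ℝ) (c := η)).div (h1.norm.const_add _)
  · intro ω η
    refine Continuous.div (by fun_prop) (by fun_prop) fun z => (hpos _).ne'
  · intro ω η
    refine Metric.equicontinuousAt_iff.2 fun ε hε => ⟨ε, hε, fun η' hη' z => ?_⟩
    rw [Real.dist_eq, ← sub_div, ← inner_sub_left, abs_div, abs_of_pos (hpos _),
      div_lt_iff₀ (hpos _)]
    rw [dist_comm, dist_eq_norm] at hη'
    calc |inner ℝ (η - η') (y ω - H z)| ≤ ‖η - η'‖ * ‖y ω - H z‖ := abs_real_inner_le_norm _ _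
      _ ≤ ε * ‖y ω - H z‖ := by gcongr
      _ < ε * (1 + ‖y ω - H z‖) := by nlinarith

section OnePeriod

variable {Ω V : Type*} {m : MeasurableSpace Ω} [mΩ : MeasurableSpace Ω]
  [NormedAddCommGroup V] [InnerProductSpace ℝ V] [FiniteDimensional ℝ V]
  [MeasurableSpace V] [BorelSpace V]

/-- A Carathéodory inequality satisfied by `X` almost surely holds on all of the conditional
support of `X`. -/
theorem IsCondSupport.ae_forall_le {P : Measure Ω} {E : Type*} [MetricSpace E] [ProperSpace E]
    {X : Ω → E} {Γ : Ω → Set E} (hΓ : IsCondSupport m P X Γ) {f : Ω → E → ℝ}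
    (hm : ∀ x, Measurable[m] fun ω => f ω x) (hc : ∀ ω, Continuous (f ω))
    (hX : ∀ᵐ ω ∂P, f ω (X ω) ≤ 0) : ∀ᵐ ω ∂P, ∀ x ∈ Γ ω, f ω x ≤ 0 :=
  hΓ.2.2 _ (isMeasurableClosedValued_setOf_le (m := m) hm hc) hX

/-- One-period fundamental theorem: with prices `y` now and `H Z` at the end of the period, no
portfolio chosen on the information `m` is an arbitrage if and only if `y` lies almost surely in
the relative interior of the convex hull of the `H`-image of the conditional support of `Z`. -/
theorem forall_gain_eq_zero_iff_mem_intrinsicInterior {P : Measure Ω} {E : Type*} [MetricSpace E]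
    [ProperSpace E] {Z : Ω → E} {Γ : Ω → Set E} (hΓ : IsCondSupport m P Z Γ)
    {H : E → V} (hH : Continuous H) {y : Ω → V} (hy : Measurable[m] y) :
    (∀ η : Ω → V, Measurable[m] η → (∀ᵐ ω ∂P, 0 ≤ inner ℝ (η ω) (H (Z ω) - y ω)) →
      ∀ᵐ ω ∂P, inner ℝ (η ω) (H (Z ω) - y ω) = 0) ↔
    ∀ᵐ ω ∂P, y ω ∈ intrinsicInterior ℝ (convexHull ℝ (H '' Γ ω)) := by
  have hgain : ∀ η : Ω → V, Measurable[m] η → ∀ x : V,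
      Measurable[m] fun ω => inner ℝ (η ω) (x - y ω) := fun η hη x =>
    Measurable.inner (𝕜 := ℝ) hη (hy.const_sub x)
  constructor
  · intro hNA
    obtain ⟨p, hpm, hpK, hpd⟩ := (hΓ.1.setOf_forall_inner_nonneg hH hy).exists_dense_selections
      (fun ω η hη ζ hζ a b ha hb _ z hz => by
        rw [inner_add_left, real_inner_smul_left, real_inner_smul_left]
        exact add_nonneg (mul_nonneg ha (hη z hz)) (mul_nonneg hb (hζ z hz)))
      (fun ω => ⟨0, fun z _ => by simp⟩)
    have hzero : ∀ᵐ ω ∂P, ∀ n, ∀ z ∈ Γ ω, inner ℝ (p n ω) (H z - y ω) ≤ 0 := by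
      refine ae_all_iff.2 fun n => hΓ.ae_forall_le (fun x => hgain _ (hpm n) (H x))
        (fun ω => by fun_prop) ?_
      filter_upwards [hNA _ (hpm n) (hΓ.2.1.mono fun ω hω => hpK n ω _ hω)] with ω hω
      exact hω.le
    filter_upwards [hzero, hΓ.2.1] with ω hω hZ
    refine mem_intrinsicInterior_of_forall_inner (convex_convexHull ℝ _)
      ⟨H (Z ω), subset_convexHull ℝ _ (Set.mem_image_of_mem H hZ)⟩
      fun η hη x hx => le_antisymm ?_ (hη x hx)
    have hle : ∀ z ∈ Γ ω, inner ℝ η (H z - y ω) ≤ 0 := by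
      intro z hz
      refine closure_minimal (t := {η : V | inner ℝ η (H z - y ω) ≤ 0}) ?_
        (isClosed_le (by fun_prop) continuous_const)
        (hpd ω fun z' hz' => hη (H z') (subset_convexHull ℝ _ (Set.mem_image_of_mem H hz')))
      rintro _ ⟨n, rfl⟩
      exact hω n z hz
    have hconv : Convex ℝ {x | inner ℝ η x ≤ inner ℝ η (y ω)} :=
      convex_halfSpace_le (innerₛₗ ℝ η).isLinear _
    have := convexHull_min (s := H '' Γ ω) (by
      rintro _ ⟨z, hz, rfl⟩
      have := hle z hz
      rw [inner_sub_right] at this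
      exact sub_nonpos.1 this) hconv hx
    rw [inner_sub_right]
    exact sub_nonpos.2 this
  · intro hri η hη hpos
    have hpos' : ∀ᵐ ω ∂P, ∀ z ∈ Γ ω, -inner ℝ (η ω) (H z - y ω) ≤ 0 :=
      hΓ.ae_forall_le (fun x => (hgain η hη (H x)).neg) (fun ω => by fun_prop)
        (hpos.mono fun ω hω => neg_nonpos.2 hω)
    filter_upwards [hri, hpos', hΓ.2.1] with ω hω hle hZ
    refine inner_sub_eq_zero_of_mem_intrinsicInterior hω (fun x hx => ?_)
      (subset_convexHull ℝ _ (Set.mem_image_of_mem H hZ))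
    have hconv : Convex ℝ {x | inner ℝ (η ω) (y ω) ≤ inner ℝ (η ω) x} :=
      convex_halfSpace_ge (innerₛₗ ℝ (η ω)).isLinear _
    have := convexHull_min (s := H '' Γ ω) (by
      rintro _ ⟨z, hz, rfl⟩
      have := hle z hz
      rw [inner_sub_right] at this
      exact sub_nonneg.1 (neg_nonpos.1 this)) hconv hx
    rw [inner_sub_right]
    exact sub_nonneg.2 this

end OnePeriod

/-! ### The bond market -/

section BondMarket

variable {Ω : Type*} {n : ℕ}

theorem forwardToPrice_apply (δ : ℝ) (z : Fin n → ℝ) (i : Fin n) :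
    forwardToPrice n δ z i = Real.exp (-∑ k, if k ≤ i then z k * δ else 0) := by
  simp only [forwardToPrice, forwardMatrix, Matrix.mulVec, dotProduct, Matrix.smul_apply,
    Matrix.of_apply, smul_eq_mul, ← Finset.sum_neg_distrib]
  congr 1
  refine Finset.sum_congr rfl fun k _ => ?_
  split_ifs <;> ring

theorem continuous_forwardToPrice (δ : ℝ) : Continuous (forwardToPrice n δ) := by
  unfold forwardToPrice
  exact continuous_pi fun i => Real.continuous_exp.comp
    ((continuous_apply i).comp (continuous_const.matrix_mulVec continuous_id))

theorem zcbPrice_zero (δ : ℝ) (f : Fin (n + 1) → ℝ) : zcbPrice δ f 0 = 1 := by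
  simp [zcbPrice]

theorem zcbPrice_one (δ : ℝ) (f : Fin (n + 1) → ℝ) : zcbPrice δ f 1 = Real.exp (-(f 0 * δ)) := by
  simp only [zcbPrice, Finset.sum_filter, Fin.sum_univ_succ]
  simp

theorem zcbPrice_succ (δ : ℝ) (f : Fin (n + 1) → ℝ) (i : Fin n) :
    zcbPrice δ f (i.val + 1) = forwardToPrice n δ (fun s => f s.castSucc) i := by
  rw [forwardToPrice_apply, zcbPrice, Finset.sum_filter, Fin.sum_univ_castSucc]
  simp only [Fin.val_castSucc, Fin.val_last, Fin.le_def, Nat.lt_succ_iff,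
    if_neg (not_le.2 i.isLt), add_zero]

theorem zcbPrice_succ_succ (δ : ℝ) (f : Fin (n + 1) → ℝ) (i : Fin n) :
    zcbPrice δ f (i.val + 1 + 1) =
      zcbPrice δ f 1 * forwardToPrice n δ (fun s => f s.succ) i := by
  rw [zcbPrice_one, forwardToPrice_apply, zcbPrice, Finset.sum_filter, Fin.sum_univ_succ,
    ← Real.exp_add, ← neg_add]
  simp only [Fin.val_zero, Fin.val_succ, Nat.succ_lt_succ_iff, Nat.lt_succ_iff, Fin.le_def,
    Nat.zero_le, if_true]

theorem zcbPrice_pos (δ : ℝ) (f : Fin (n + 1) → ℝ) (T : ℕ) : 0 < zcbPrice δ f T :=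
  Real.exp_pos _

theorem measurable_zcbPrice {m : MeasurableSpace Ω} (δ : ℝ) {f : Ω → Fin (n + 1) → ℝ}
    (hf : Measurable f) (T : ℕ) : Measurable fun ω => zcbPrice δ (f ω) T := by
  refine Real.measurable_exp.comp (Measurable.neg (Finset.measurable_sum _ fun s _ => ?_))
  exact ((measurable_pi_apply s).comp hf).mul_const δ

theorem measurable_comp_index {m : MeasurableSpace Ω} {ι κ : Type*} {f : Ω → ι → ℝ}
    (hf : Measurable f) (g : κ → ι) : Measurable fun ω k => f ω (g k) :=
  measurable_pi_lambda _ fun k => (measurable_pi_apply (g k)).comp hf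

theorem measurable_finCons {m : MeasurableSpace Ω} {b : Ω → ℝ} {ζ : Ω → Fin n → ℝ}
    (hb : Measurable b) (hζ : Measurable ζ) :
    Measurable fun ω => (Fin.cons (b ω) (ζ ω) : Fin (n + 1) → ℝ) := by
  refine measurable_pi_lambda _ fun j => ?_
  refine Fin.cases ?_ (fun i => ?_) j
  · simpa using hb
  · simpa using (measurable_pi_iff.1 hζ i)

/-- Gain over `(t, t + 1]`, in units of cash at `t + 1`, from holding `η i` units of the bond
maturing at `t + 2 + i`, financed by the bond that matures at `t + 1`. -/
noncomputable def bondGain (δ : ℝ) (F : ℕ → Ω → Fin (n + 1) → ℝ) (t : ℕ) (η : Ω → Fin n → ℝ)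
    (ω : Ω) : ℝ :=
  ∑ i, η ω i * (forwardToPrice n δ (fun s => F (t + 1) ω s.castSucc) i -
    forwardToPrice n δ (fun s => F t ω s.succ) i)

theorem bondWealth_succ (δ : ℝ) (F : ℕ → Ω → Fin (n + 1) → ℝ) (θ : ℕ → Ω → Fin (n + 1) → ℝ)
    (t : ℕ) (ω : Ω) : bondWealth δ F θ (t + 1) ω =
      θ t ω 0 + ∑ i : Fin n, θ t ω i.succ * forwardToPrice n δ (fun s => F (t + 1) ω s.castSucc) i
      := by
  rw [bondWealth, Fin.sum_univ_succ]
  simp only [Fin.val_zero, zcbPrice_zero, mul_one, Fin.val_succ, zcbPrice_succ]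

theorem bondPortfolioCost_eq (δ : ℝ) (F : ℕ → Ω → Fin (n + 1) → ℝ)
    (θ : ℕ → Ω → Fin (n + 1) → ℝ) (t : ℕ) (ω : Ω) : bondPortfolioCost δ F θ t ω =
      zcbPrice δ (F t ω) 1 *
        (θ t ω 0 + ∑ i : Fin n, θ t ω i.succ * forwardToPrice n δ (fun s => F t ω s.succ) i) := by
  rw [bondPortfolioCost, Fin.sum_univ_succ, mul_add, Finset.mul_sum]
  simp only [Fin.val_zero, zero_add, Fin.val_succ, zcbPrice_succ_succ]
  rw [mul_comm]
  exact congrArg _ (Finset.sum_congr rfl fun i _ => by ring)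

theorem bondWealth_succ_eq_cost_add_gain (δ : ℝ) (F : ℕ → Ω → Fin (n + 1) → ℝ)
    (θ : ℕ → Ω → Fin (n + 1) → ℝ) (t : ℕ) (ω : Ω) : bondWealth δ F θ (t + 1) ω =
      bondPortfolioCost δ F θ t ω / zcbPrice δ (F t ω) 1 +
        bondGain δ F t (fun ω i => θ t ω i.succ) ω := by
  rw [bondWealth_succ, bondPortfolioCost_eq, mul_div_cancel_left₀ _ (zcbPrice_pos _ _ _).ne',
    bondGain, add_assoc, ← Finset.sum_add_distrib]
  exact congrArg _ (Finset.sum_congr rfl fun i _ => by ring)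

variable {mΩ : MeasurableSpace Ω} {P : Measure Ω} {ℱ : Filtration ℕ mΩ} {N : ℕ} {δ : ℝ}
  {F : ℕ → Ω → Fin (n + 1) → ℝ}

theorem measurable_bondWealth (hF : ∀ t ≤ N, Measurable[ℱ t] (F t))
    {θ : ℕ → Ω → Fin (n + 1) → ℝ} (hθ : ∀ t < N, Measurable[ℱ t] (θ t)) {t : ℕ} (ht : t ≤ N) :
    Measurable[ℱ t] (bondWealth δ F θ t) := by
  cases t with
  | zero => exact measurable_const
  | succ t =>
    refine Finset.measurable_sum _ fun j _ => ?_
    exact ((measurable_pi_apply j).comp ((hθ t ht).mono (ℱ.mono t.le_succ) le_rfl)).mul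
      (measurable_zcbPrice δ (hF _ ht) j.val)

theorem measurable_bondGain (hF : ∀ t ≤ N, Measurable[ℱ t] (F t)) {t : ℕ} (ht : t < N)
    {η : Ω → Fin n → ℝ} (hη : Measurable[ℱ t] η) : Measurable[ℱ (t + 1)] (bondGain δ F t η) := by
  refine Finset.measurable_sum _ fun i _ => ?_
  have hH := (measurable_pi_apply i).comp (continuous_forwardToPrice (n := n) δ).measurable
  refine ((measurable_pi_apply i).comp (hη.mono (ℱ.mono t.le_succ) le_rfl)).mul (.sub ?_ ?_)
  · exact hH.comp (measurable_comp_index (hF _ ht) Fin.castSucc)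
  · exact hH.comp (measurable_comp_index ((hF _ ht.le).mono (ℱ.mono t.le_succ) le_rfl) Fin.succ)

/-- A profitable one-period portfolio is turned into a strategy over the whole horizon by doing
nothing before time `t` and rolling the gain over into the shortest bond after time `t + 1`. -/
theorem BondMarketArbitrageFree.ae_bondGain_eq_zero (h : BondMarketArbitrageFree P ℱ δ F N)
    (hF : ∀ t ≤ N, Measurable[ℱ t] (F t)) {t : ℕ} (ht : t < N) {η : Ω → Fin n → ℝ}
    (hη : Measurable[ℱ t] η) (hpos : ∀ᵐ ω ∂P, 0 ≤ bondGain δ F t η ω) :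
    ∀ᵐ ω ∂P, bondGain δ F t η ω = 0 := by
  -- `c s` is the wealth at time `s + 1`, for `t ≤ s`.
  let c : ℕ → Ω → ℝ := fun s ω =>
    bondGain δ F t η ω * Real.exp (∑ u ∈ Finset.Ioc t s, F u ω 0 * δ)
  let a : Ω → ℝ := fun ω => -∑ i, η ω i * forwardToPrice n δ (fun s => F t ω s.succ) i
  let θ : ℕ → Ω → Fin (n + 1) → ℝ := fun s ω =>
    if s < t then 0 else if s = t then Fin.cons (a ω) (η ω) else Fin.cons (c s ω) 0
  have hθt : ∀ ω, θ t ω = Fin.cons (a ω) (η ω) := fun ω => by simp [θ]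
  have hθlt : ∀ s < t, ∀ ω, θ s ω = 0 := fun s hs ω => by simp [θ, hs]
  have hθgt : ∀ s, t < s → ∀ ω, θ s ω = Fin.cons (c s ω) 0 := fun s hs ω => by
    simp [θ, hs.le.not_gt, hs.ne']
  have hWle : ∀ s ≤ t, ∀ ω, bondWealth δ F θ s ω = 0 := by
    intro s hs ω
    cases s with
    | zero => rfl
    | succ s => rw [bondWealth_succ, hθlt s hs]; simp
  have hWgt : ∀ s, t ≤ s → ∀ ω, bondWealth δ F θ (s + 1) ω = c s ω := by
    intro s hs ω
    rw [bondWealth_succ]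
    rcases hs.eq_or_lt with rfl | hs
    · simp only [hθt, Fin.cons_zero, Fin.cons_succ, c, a, bondGain, Finset.Ioc_self,
        Finset.sum_empty, Real.exp_zero, mul_one, mul_sub, Finset.sum_sub_distrib]
      ring
    · simp [hθgt s hs]
  have hcost : ∀ s ω, bondPortfolioCost δ F θ s ω = bondWealth δ F θ s ω := by
    intro s ω
    rw [bondPortfolioCost_eq]
    rcases lt_trichotomy s t with hs | rfl | hs
    · rw [hWle s hs.le, hθlt s hs]; simp
    · rw [hWle s le_rfl, hθt]; simp [a]
    · obtain ⟨s, rfl⟩ : ∃ r, s = r + 1 := ⟨s - 1, by omega⟩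
      rw [hWgt s (by omega), hθgt _ hs, zcbPrice_one]
      simp only [Fin.cons_zero, Fin.cons_succ, Pi.zero_apply, zero_mul, Finset.sum_const_zero,
        add_zero, c]
      rw [Finset.sum_Ioc_succ_top (by omega), Real.exp_add, Real.exp_neg]
      field_simp
  have hθm : ∀ s < N, Measurable[ℱ s] (θ s) := by
    intro s hs
    rcases lt_trichotomy s t with hst | rfl | hst
    · rw [funext (hθlt s hst)]; exact measurable_const
    · rw [funext hθt]
      refine measurable_finCons (Measurable.neg (Finset.measurable_sum _ fun i _ => ?_)) hη
      refine ((measurable_pi_apply i).comp hη).mul ((measurable_pi_apply i).comp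
        ((continuous_forwardToPrice (n := n) δ).measurable.comp ?_))
      exact measurable_comp_index (hF _ hs.le) Fin.succ
    · rw [funext (hθgt s hst)]
      refine measurable_finCons (Measurable.mul ?_ (Real.measurable_exp.comp ?_)) measurable_const
      · exact (measurable_bondGain hF ht hη).mono (ℱ.mono hst) le_rfl
      · refine Finset.measurable_sum _ fun u hu => ?_
        have hus := (Finset.mem_Ioc.1 hu).2
        exact ((measurable_pi_apply 0).comp
          ((hF u (hus.trans hs.le)).mono (ℱ.mono hus) le_rfl)).mul_const δ
  obtain ⟨r, rfl⟩ : ∃ r, N = r + 1 := ⟨N - 1, by omega⟩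
  have hW := hWgt r (by omega)
  have h0 := h θ hθm (fun s _ => .of_forall (hcost s)) (hpos.mono fun ω hω => by
    rw [hW]; exact mul_nonneg hω (Real.exp_pos _).le)
  filter_upwards [h0] with ω hω
  rw [hW] at hω
  exact (mul_eq_zero.1 hω).resolve_right (Real.exp_pos _).ne'

/-- If no single period admits an arbitrage, then neither does the whole market. By induction
on the horizon it suffices that the wealth at the last rebalancing is nonnegative: otherwise the last
portfolio, held only where that wealth is negative, would be a one-period arbitrage. -/
theorem bondMarketArbitrageFree_of_forall_bondGain (hF : ∀ t ≤ N, Measurable[ℱ t] (F t))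
    (h : ∀ t < N, ∀ η : Ω → Fin n → ℝ, Measurable[ℱ t] η →
      (∀ᵐ ω ∂P, 0 ≤ bondGain δ F t η ω) → ∀ᵐ ω ∂P, bondGain δ F t η ω = 0) :
    BondMarketArbitrageFree P ℱ δ F N := by
  intro θ hθ hsf
  suffices H : ∀ t ≤ N, (∀ᵐ ω ∂P, 0 ≤ bondWealth δ F θ t ω) →
      ∀ᵐ ω ∂P, bondWealth δ F θ t ω = 0 from H N le_rfl
  intro t
  induction t with
  | zero => exact fun _ _ => .of_forall fun _ => rfl
  | succ t ih =>
    intro ht hpos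
    let η : Ω → Fin n → ℝ := fun ω i => θ t ω i.succ
    have hη : Measurable[ℱ t] η := measurable_comp_index (hθ t ht) Fin.succ
    let A : Set Ω := {ω | bondWealth δ F θ t ω < 0}
    have hA : MeasurableSet[ℱ t] A :=
      measurableSet_lt (measurable_bondWealth hF hθ (Nat.le_of_succ_le ht)) measurable_const
    have hW : ∀ᵐ ω ∂P, bondWealth δ F θ (t + 1) ω =
        bondWealth δ F θ t ω / zcbPrice δ (F t ω) 1 + bondGain δ F t η ω := by
      filter_upwards [hsf t ht] with ω hω
      rw [bondWealth_succ_eq_cost_add_gain, hω]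
    have hmem : ∀ ω ∈ A, bondGain δ F t (A.indicator η) ω = bondGain δ F t η ω :=
      fun ω hω => by simp only [bondGain, Set.indicator_of_mem hω]
    have hnotMem : ∀ ω ∉ A, bondGain δ F t (A.indicator η) ω = 0 :=
      fun ω hω => by simp [bondGain, Set.indicator_of_notMem hω]
    have hgainA : ∀ᵐ ω ∂P, ω ∈ A → 0 < bondGain δ F t (A.indicator η) ω := by
      filter_upwards [hW, hpos] with ω hω h0 hωA
      rw [hmem ω hωA]
      have := div_neg_of_neg_of_pos hωA (zcbPrice_pos δ (F t ω) 1)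
      linarith
    have hzero := h t ht (A.indicator η) (hη.indicator hA) (by
      filter_upwards [hgainA] with ω hω
      by_cases hωA : ω ∈ A
      · exact (hω hωA).le
      · exact (hnotMem ω hωA).ge)
    have hWt := ih (Nat.le_of_succ_le ht) (by
      filter_upwards [hgainA, hzero] with ω hω h0
      by_contra hneg
      exact (hω (not_le.1 hneg)).ne' h0)
    have hgain : ∀ᵐ ω ∂P, bondWealth δ F θ (t + 1) ω = bondGain δ F t η ω := by
      filter_upwards [hW, hWt] with ω hω h0
      rw [hω, h0, zero_div, zero_add]
    have := h t ht η hη (by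
      filter_upwards [hgain, hpos] with ω hω h0
      rwa [← hω])
    filter_upwards [hgain, this] with ω hω h0
    rw [hω, h0]

theorem bondMarketArbitrageFree_iff_forall_bondGain (hF : ∀ t ≤ N, Measurable[ℱ t] (F t)) :
    BondMarketArbitrageFree P ℱ δ F N ↔ ∀ t < N, ∀ η : Ω → Fin n → ℝ, Measurable[ℱ t] η →
      (∀ᵐ ω ∂P, 0 ≤ bondGain δ F t η ω) → ∀ᵐ ω ∂P, bondGain δ F t η ω = 0 :=
  ⟨fun h _ ht _ hη => h.ae_bondGain_eq_zero hF ht hη, bondMarketArbitrageFree_of_forall_bondGain hF⟩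

theorem toLp_mem_intrinsicInterior_convexHull_iff {E : Type*} (H : E → Fin n → ℝ) (S : Set E)
    (y : Fin n → ℝ) :
    WithLp.toLp 2 y ∈ intrinsicInterior ℝ (convexHull ℝ ((fun z => WithLp.toLp 2 (H z)) '' S)) ↔
      y ∈ intrinsicInterior ℝ (convexHull ℝ (H '' S)) := by
  let e : (Fin n → ℝ) ≃ₗ[ℝ] EuclideanSpace ℝ (Fin n) := (WithLp.linearEquiv 2 ℝ _).symm
  have himg : convexHull ℝ ((fun z => WithLp.toLp 2 (H z)) '' S) =
      e.toAffineEquiv '' convexHull ℝ (H '' S) := by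
    have h1 : (fun z => WithLp.toLp 2 (H z)) '' S = e.toLinearMap '' (H '' S) := by
      rw [Set.image_image]; rfl
    rw [h1, ← LinearMap.image_convexHull]; rfl
  rw [himg, AffineEquiv.intrinsicInterior_image]
  exact e.injective.mem_set_image

theorem forall_bondGain_iff_mem_intrinsicInterior [IsFiniteMeasure P]
    (hF : ∀ t ≤ N, Measurable[ℱ t] (F t)) {t : ℕ} (ht : t < N) :
    (∀ η : Ω → Fin n → ℝ, Measurable[ℱ t] η →
      (∀ᵐ ω ∂P, 0 ≤ bondGain δ F t η ω) → ∀ᵐ ω ∂P, bondGain δ F t η ω = 0) ↔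
    ∀ᵐ ω ∂P, forwardToPrice n δ (fun s => F t ω s.succ) ∈
      intrinsicInterior ℝ (convexHull ℝ (forwardToPrice n δ ''
        condSupport (ℱ t) P (fun ω' (s : Fin n) => F (t + 1) ω' s.castSucc) ω)) := by
  have hZ : Measurable fun ω (s : Fin n) => F (t + 1) ω s.castSucc :=
    measurable_comp_index ((hF (t + 1) ht).mono (ℱ.le _) le_rfl) Fin.castSucc
  have hy : Measurable[ℱ t] fun ω => (WithLp.toLp 2
      (forwardToPrice n δ fun s => F t ω s.succ) : EuclideanSpace ℝ (Fin n)) :=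
    (WithLp.measurable_toLp 2 _).comp ((continuous_forwardToPrice δ).measurable.comp
      (measurable_comp_index (hF t ht.le) Fin.succ))
  have key := forall_gain_eq_zero_iff_mem_intrinsicInterior
    (isCondSupport_condSupport (ℱ.le t) P hZ)
    (H := fun z => (WithLp.toLp 2 (forwardToPrice n δ z) : EuclideanSpace ℝ (Fin n)))
    ((PiLp.continuous_toLp 2 _).comp (continuous_forwardToPrice δ)) hy
  simp only [toLp_mem_intrinsicInterior_convexHull_iff] at key
  rw [← key]
  have hgain : ∀ (η : Ω → EuclideanSpace ℝ (Fin n)) (ω : Ω), inner ℝ (η ω)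
      (WithLp.toLp 2 (forwardToPrice n δ fun s => F (t + 1) ω s.castSucc) -
        WithLp.toLp 2 (forwardToPrice n δ fun s => F t ω s.succ)) =
      bondGain δ F t (fun ω => WithLp.ofLp (η ω)) ω := fun η ω => by
    simp [bondGain, PiLp.inner_apply, mul_comm]
  simp only [hgain]
  refine ⟨fun h η hη => h _ ((WithLp.measurable_ofLp 2 _).comp hη), fun h η hη => ?_⟩
  exact h (fun ω => WithLp.toLp 2 (η ω)) ((WithLp.measurable_toLp 2 _).comp hη)

end BondMarket

theorem mainTheorem1 {Ω : Type*} {mΩ : MeasurableSpace Ω} (P : Measure Ω) [IsProbabilityMeasure P]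
    (ℱ : Filtration ℕ mΩ) (N Tbar : ℕ) (δ : ℝ) (hδ : 0 < δ)
    (F : ℕ → Ω → Fin (Tbar + 1) → ℝ) (hF : ∀ t ≤ N, Measurable[ℱ t] (F t)) :
    BondMarketArbitrageFree P ℱ δ F N ↔
      ∀ᵐ ω ∂P, ∀ t < N,
        forwardToPrice Tbar δ (fun s : Fin Tbar => F t ω s.succ) ∈
          intrinsicInterior ℝ (convexHull ℝ (forwardToPrice Tbar δ ''
            condSupport (ℱ t) P (fun ω' (s : Fin Tbar) => F (t + 1) ω' s.castSucc) ω)) := by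
  rw [bondMarketArbitrageFree_iff_forall_bondGain hF, ae_all_iff]
  refine forall_congr' fun t => ?_
  rw [ae_all_iff]
  exact forall_congr' fun ht => forall_bondGain_iff_mem_intrinsicInterior hF ht
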